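/- Let $\Gamma$ be the Gamma function and $\psi=\Gamma'/\Gamma$ the digamma function. Let $a\in\mathbb{C}$ with $\Re(a)<2$ and $a\notin\{0,-\tfrac12,-1,-\tfrac32,\dots\}$, and let $z\in\mathbb{C}$ satisfy $|z|<|a+k|$ for every integer $k\ge 0$ (for $\Re(a)\ge-\tfrac12$ this just means $|z|<|a|$). Then the iterated series $$S_1(a,z)=\sum_{k=0}^{\infty}\sum_{n=1}^{\infty}\frac{4(-1)^k\,\psi(2a+k)\,\Gamma(2a+k)}{k!\,(a+k)^{2n+1}}\,z^{2n},\qquad S_2(a,z)=\sum_{k=0}^{\infty}\sum_{n=1}^{\infty}\frac{2(2n+1)(-1)^k\,\Gamma(2a+k)}{k!\,(a+k)^{2n+2}}\,z^{2n}$$ converge (the inner series absolutely, the outer series in the sense of its ordered partial sums), and $$\Gamma(a+z)\,\Gamma(a-z)\,\bigl(\psi(a+z)+\psi(a-z)\bigr)=2\,\psi(a)\,\Gamma(a)^2+S_1(a,z)-S_2(a,z).$$ -/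

import Mathlib

/-- The term with indices `k` and `n` of the double series `S₁(a, z)`, where `ψ` is the digamma
function: `4 (-1)^k ψ(2a+k) Γ(2a+k) / (k! (a+k)^(2n+1)) * z^(2n)`. -/
noncomputable def termS1 (a z : ℂ) (k n : ℕ) : ℂ :=
  4 * (-1) ^ k * Complex.digamma (2 * a + k) * Complex.Gamma (2 * a + k) /
    ((Nat.factorial k : ℂ) * (a + k) ^ (2 * n + 1)) * z ^ (2 * n)

/-- The term with indices `k` and `n` of the double series `S₂(a, z)`:
`2 (2n+1) (-1)^k Γ(2a+k) / (k! (a+k)^(2n+2)) * z^(2n)`. -/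
noncomputable def termS2 (a z : ℂ) (k n : ℕ) : ℂ :=
  2 * (2 * (n : ℂ) + 1) * (-1) ^ k * Complex.Gamma (2 * a + k) /
    ((Nat.factorial k : ℂ) * (a + k) ^ (2 * n + 2)) * z ^ (2 * n)

/-- `S` is the value of the iterated series `∑_{k = 0}^∞ ∑_{n = 1}^∞ t k n`: every inner series
converges (absolutely), and the outer series, which need not converge absolutely, converges to `S`
in the sense of its ordered partial sums. -/
def HasIteratedSum (t : ℕ → ℕ → ℂ) (S : ℂ) : Prop :=
  ∃ s : ℕ → ℂ, (∀ k, HasSum (fun n : ℕ => t k (n + 1)) (s k)) ∧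
    Filter.Tendsto (fun N : ℕ => ∑ k ∈ Finset.range N, s k) Filter.atTop (nhds S)

open Filter Topology Finset Metric

/-! The identity is the derivative in `a` of the expansion Γ(a+z)Γ(a-z) = Γ(a)² + ∑ (-1)^k
Γ(2a+k)/k! · (1/(a+k-z) + 1/(a+k+z) - 2/(a+k)). Differentiating Γ(2a+k) produces the terms of S₁ and
differentiating the kernel those of S₂, once the kernels are expanded as geometric series in
z²/(a+k)².

The expansion comes from Euler's approximations: `GammaSeq (a + z) n * GammaSeq (a - z) n` is, up to
a factor free of z, the reciprocal of a polynomial in z² with roots (a+k)², k ≤ n. Its partial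
fractions (`sum_gammaCoeff_mul_eulerCutoff`) are the series above with a cut-off factor tending to
1; the case z = 0 is subtracted so that the kernel decays like k⁻³.

Terms are O(k^(2 Re a - 4)): they tend to 0 for Re a < 2 but need not be absolutely summable. Adding
consecutive terms gains a factor 1/k, provided the cut-off varies slowly
(`exists_eulerCutoff_bound`). The paired series is then dominated uniformly in n and locally
uniformly in `a`, which justifies both n → ∞ (`hasSum_gammaProdTerm_pair`) and termwise
differentiation (`hasSum_deriv_gammaProdTerm_pair`). Pairs are undone at the end because the
differentiated terms tend to 0. -/

/-! ### Partial fractions of the product of two Euler approximations -/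

lemma prod_natCast_sub_ne (n k : ℕ) (hk : k ≤ n) :
    ∏ j ∈ (range (n + 1)).erase k, ((k : ℂ) - j) =
      (-1) ^ (n - k) * (k.factorial * (n - k).factorial) := by
  obtain ⟨m, rfl⟩ := Nat.exists_eq_add_of_le hk
  have h1 : ∏ j ∈ (range (k + m + 1)).erase k, ((k : ℂ) - j) =
      ∏ j ∈ (range (k + m + 1)).erase k, (if j = k then (1 : ℂ) else (k : ℂ) - j) :=
    prod_congr rfl fun j hj => by rw [if_neg (mem_erase.1 hj).1]
  rw [h1, prod_erase (f := fun j : ℕ => if j = k then (1 : ℂ) else (k : ℂ) - j) _ (if_pos rfl),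
    show k + m + 1 = k + 1 + m by ring, prod_range_add,
    prod_range_succ, if_pos rfl, mul_one, Nat.add_sub_cancel_left]
  have h2 : ∏ j ∈ range k, (if j = k then (1 : ℂ) else (k : ℂ) - j) = k.factorial := by
    rw [← prod_range_reflect, ← prod_range_add_one_eq_factorial, Nat.cast_prod]
    refine prod_congr rfl fun j hj => ?_
    have hj := mem_range.1 hj
    rw [if_neg (by omega), show k - 1 - j = k - (j + 1) by omega, Nat.cast_sub (by omega)]
    ring
  have h3 : ∏ j ∈ range m, (if k + 1 + j = k then (1 : ℂ) else (k : ℂ) - ((k + 1 + j : ℕ) : ℂ)) =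
      (-1) ^ m * m.factorial := by
    rw [← prod_range_add_one_eq_factorial, Nat.cast_prod]
    nth_rewrite 2 [← card_range m]
    rw [← prod_const, ← prod_mul_distrib]
    refine prod_congr rfl fun j hj => ?_
    rw [if_neg (by omega)]
    push_cast
    ring
  rw [h2, h3]
  ring

/-- Partial fraction expansion of `∏ 1 / ((a + j)² - x)`. -/
lemma sum_partialFraction_sq (a x : ℂ) (n : ℕ) (h2a : ∀ m : ℕ, 2 * a ≠ -(m : ℂ))
    (hx : ∀ k : ℕ, (a + k) ^ 2 ≠ x) :
    ∑ k ∈ range (n + 1), (-1) ^ k * (2 * (a + k) / ((a + k) ^ 2 - x)) /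
        (k.factorial * (n - k).factorial * ∏ j ∈ range (n + 1), (2 * a + k + j)) =
      (∏ j ∈ range (n + 1), ((a + j) ^ 2 - x))⁻¹ := by
  have hs (m : ℕ) : 2 * a + m ≠ 0 := fun h => h2a m (eq_neg_of_add_eq_zero_left h)
  -- The factor 2a+i+j never vanishes, so the nodes (a+k)² are distinct.
  have hfac (i j : ℕ) : (a + i) ^ 2 - (a + j) ^ 2 = ((i : ℂ) - j) * (2 * a + i + j) := by ring
  have hinj : Set.InjOn (fun k : ℕ => (a + k) ^ 2) (range (n + 1)) := by
    intro i _ j _ hij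
    have h : ((i : ℂ) - j) * (2 * a + i + j) = 0 := by rw [← hfac]; exact sub_eq_zero.2 hij
    rcases mul_eq_zero.1 h with h | h
    · exact_mod_cast sub_eq_zero.1 h
    · exact absurd (by rw [← h]; push_cast; ring) (hs (i + j))
  -- Interpolating the constant 1 at the nodes (a+k)² in barycentric form, and evaluating at `x`, is
  -- the partial fraction expansion.
  have key := Lagrange.eval_interpolate_not_at_node (s := range (n + 1))
    (v := fun k : ℕ => (a + k) ^ 2) (x := x) 1 (fun i _ => (hx i).symm)
  rw [Lagrange.interpolate_one hinj ⟨0, by simp⟩, Polynomial.eval_one, Lagrange.eval_nodal] at key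
  have hneg : ∏ i ∈ range (n + 1), (x - (a + i) ^ 2) =
      (-1) ^ (n + 1) * ∏ i ∈ range (n + 1), ((a + i) ^ 2 - x) := by
    nth_rewrite 2 [← card_range (n + 1)]
    rw [← prod_const, ← prod_mul_distrib]
    exact prod_congr rfl fun i _ => by ring
  have hprod : ∏ i ∈ range (n + 1), ((a + i) ^ 2 - x) ≠ 0 :=
    prod_ne_zero_iff.2 fun i _ => sub_ne_zero.2 (hx i)
  rw [hneg] at key
  refine eq_inv_of_mul_eq_one_right (Eq.trans ?_ key.symm)
  rw [mul_comm ((-1 : ℂ) ^ (n + 1)), mul_assoc]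
  congr 1
  rw [mul_sum]
  refine sum_congr rfl fun k hk => ?_
  have hkn : k ≤ n := by have := mem_range.1 hk; omega
  have hw : Lagrange.nodalWeight (range (n + 1)) (fun k : ℕ => (a + k) ^ 2) k =
      (((-1) ^ (n - k) * (k.factorial * (n - k).factorial)) *
        ∏ j ∈ (range (n + 1)).erase k, (2 * a + k + j))⁻¹ := by
    rw [Lagrange.nodalWeight, prod_inv_distrib, ← prod_natCast_sub_ne n k hkn,
      ← prod_mul_distrib]
    congr 1
    exact prod_congr rfl fun j _ => hfac k j
  have herase := mul_prod_erase (range (n + 1)) (fun j : ℕ => 2 * a + (k : ℂ) + j) hk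
  have hP : ∏ j ∈ (range (n + 1)).erase k, (2 * a + (k : ℂ) + j) ≠ 0 :=
    prod_ne_zero_iff.2 fun j _ => by simpa [add_assoc] using hs (k + j)
  have hkk : 2 * a + (k : ℂ) + k ≠ 0 := by simpa [add_assoc] using hs (k + k)
  have hxk := sub_ne_zero.2 (hx k)
  have hf1 : (k.factorial : ℂ) ≠ 0 := by exact_mod_cast k.factorial_ne_zero
  have hf2 : ((n - k).factorial : ℂ) ≠ 0 := by exact_mod_cast (n - k).factorial_ne_zero
  have hsign : (-1 : ℂ) ^ (n + 1) = -((-1) ^ k * (-1) ^ (n - k)) := by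
    rw [← pow_add, Nat.add_sub_cancel' hkn, pow_succ]; ring
  have hsq : ((-1 : ℂ) ^ (n - k))⁻¹ = (-1) ^ (n - k) := by
    rw [← inv_pow]; norm_num
  have hsq' : (-1 : ℂ) ^ (n - k) * (-1) ^ (n - k) = 1 := by rw [← mul_pow]; norm_num
  have hinv : (x - (a + k) ^ 2)⁻¹ = -((a + k) ^ 2 - x)⁻¹ := by rw [← neg_sub, inv_neg]
  rw [hw, ← herase, mul_inv, mul_inv, hsq, hsign, hinv, Pi.one_apply]
  rw [show -((-1 : ℂ) ^ k * (-1) ^ (n - k)) * ((-1) ^ (n - k) *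
      ((k.factorial : ℂ) * (n - k).factorial)⁻¹ *
      (∏ j ∈ (range (n + 1)).erase k, (2 * a + (k : ℂ) + j))⁻¹ * -((a + k) ^ 2 - x)⁻¹ * 1) =
      (-1) ^ k * ((-1) ^ (n - k) * (-1) ^ (n - k)) * ((k.factorial : ℂ) * (n - k).factorial)⁻¹ *
      (∏ j ∈ (range (n + 1)).erase k, (2 * a + (k : ℂ) + j))⁻¹ * ((a + k) ^ 2 - x)⁻¹ by ring, hsq']
  field_simp
  ring

lemma Gamma_add_natCast_eq_mul_prod (s : ℂ) (hs : ∀ m : ℕ, s ≠ -(m : ℂ)) (k : ℕ) :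
    Complex.Gamma (s + k) = Complex.Gamma s * ∏ j ∈ range k, (s + j) := by
  induction k with
  | zero => simp
  | succ k ih =>
    rw [prod_range_succ, ← mul_assoc, ← ih, Nat.cast_succ, ← add_assoc,
      Complex.Gamma_add_one _ fun h => hs k (eq_neg_of_add_eq_zero_left h), mul_comm]

/-- `Γ(s + k) / k!`. -/
noncomputable def gammaCoeff (s : ℂ) (k : ℕ) : ℂ := Complex.Gamma (s + k) / k.factorial

lemma gammaCoeff_succ (s : ℂ) (hs : ∀ m : ℕ, s ≠ -(m : ℂ)) (k : ℕ) :
    gammaCoeff s (k + 1) = gammaCoeff s k * ((s + k) / (k + 1)) := by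
  have : (k.factorial : ℂ) ≠ 0 := by exact_mod_cast k.factorial_ne_zero
  have h1 : (k : ℂ) + 1 ≠ 0 := by exact_mod_cast k.succ_ne_zero
  rw [gammaCoeff, gammaCoeff, Nat.cast_succ, ← add_assoc,
      Complex.Gamma_add_one _ fun h => hs k (eq_neg_of_add_eq_zero_left h), Nat.factorial_succ]
  push_cast
  field_simp

/-- The cut-off factor which turns the series of residues of `Γ(a + z) Γ(a - z)` (with `s = 2 a`)
into the partial fraction expansion of the product of the two Euler approximations. -/
noncomputable def eulerCutoff (s : ℂ) (n k : ℕ) : ℂ :=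
  Complex.GammaSeq s n / Complex.Gamma s * ∏ j ∈ range k, (((n : ℂ) - j) / (s + n + j + 1))

lemma eulerCutoff_succ (s : ℂ) (n k : ℕ) :
    eulerCutoff s n (k + 1) = eulerCutoff s n k * (((n : ℂ) - k) / (s + n + k + 1)) := by
  rw [eulerCutoff, prod_range_succ, ← mul_assoc, eulerCutoff]

lemma eulerCutoff_eq_zero (s : ℂ) {n k : ℕ} (h : n < k) : eulerCutoff s n k = 0 := by
  rw [eulerCutoff, prod_eq_zero (mem_range.2 h) (by simp), mul_zero]

/-- Links the residue of the limit to the coefficient found by interpolation; this is the identity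
that dictates the form of the cut-off. -/
lemma gammaCoeff_mul_eulerCutoff (s : ℂ) (hs : ∀ m : ℕ, s ≠ -(m : ℂ)) {n k : ℕ} (hk : k ≤ n) :
    gammaCoeff s k * eulerCutoff s n k = (n : ℂ) ^ s * n.factorial * n.factorial /
      (k.factorial * (n - k).factorial * ∏ j ∈ range (n + 1), (s + k + j)) := by
  have hs' (m : ℕ) : s + m ≠ 0 := fun h => hs m (eq_neg_of_add_eq_zero_left h)
  have hG := Complex.Gamma_ne_zero hs
  have h1 : ∏ j ∈ range k, ((n : ℂ) - j) = n.factorial / (n - k).factorial := by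
    rw [eq_div_iff (by exact_mod_cast (n - k).factorial_ne_zero)]
    rw [← Nat.factorial_mul_descFactorial hk, Nat.descFactorial_eq_prod_range]
    push_cast
    rw [mul_comm]
    congr 1
    refine prod_congr rfl fun j hj => ?_
    rw [Nat.cast_sub (by have := mem_range.1 hj; omega)]
  -- Both sides are the product of s + j over j < n + k + 1, split at n + 1 and at k.
  have h2 : (∏ j ∈ range (n + 1), (s + j)) * ∏ j ∈ range k, (s + n + j + 1) =
      (∏ j ∈ range k, (s + j)) * ∏ j ∈ range (n + 1), (s + k + j) := by
    have e1 := prod_range_add (fun j : ℕ => s + (j : ℂ)) (n + 1) k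
    have e2 := prod_range_add (fun j : ℕ => s + (j : ℂ)) k (n + 1)
    rw [add_comm (n + 1) k, e2] at e1
    convert! e1.symm using 2
    · exact prod_congr rfl fun j _ => by push_cast; ring
    · exact prod_congr rfl fun j _ => by push_cast; ring
  have p1 : ∏ j ∈ range (n + 1), (s + j) ≠ 0 := prod_ne_zero_iff.2 fun j _ => hs' j
  have p2 : ∏ j ∈ range k, (s + n + j + 1) ≠ 0 := prod_ne_zero_iff.2 fun j _ => by
    have := hs' (n + j + 1); push_cast at this; simpa [add_assoc] using this
  have p3 : ∏ j ∈ range (n + 1), (s + k + j) ≠ 0 := prod_ne_zero_iff.2 fun j _ => by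
    have := hs' (k + j); push_cast at this; simpa [add_assoc] using this
  have hf1 : (k.factorial : ℂ) ≠ 0 := by exact_mod_cast k.factorial_ne_zero
  have hf2 : ((n - k).factorial : ℂ) ≠ 0 := by exact_mod_cast (n - k).factorial_ne_zero
  rw [gammaCoeff, eulerCutoff, prod_div_distrib, h1, Gamma_add_natCast_eq_mul_prod s hs,
    Complex.GammaSeq]
  field_simp
  linear_combination (-(n : ℂ) ^ s * n.factorial ^ 2) * h2

/-- The partial fraction expansion of the product of the two Euler approximations. -/
lemma sum_gammaCoeff_mul_eulerCutoff (a z : ℂ) (h2a : ∀ m : ℕ, 2 * a ≠ -(m : ℂ))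
    (hz : ∀ k : ℕ, (a + k) ^ 2 ≠ z ^ 2) {n : ℕ} (hn : n ≠ 0) :
    ∑ k ∈ range (n + 1), (-1) ^ k * (gammaCoeff (2 * a) k * eulerCutoff (2 * a) n k) *
        (2 * (a + k) / ((a + k) ^ 2 - z ^ 2)) =
      Complex.GammaSeq (a + z) n * Complex.GammaSeq (a - z) n := by
  have h := sum_partialFraction_sq a (z ^ 2) n h2a hz
  have hp : ∏ j ∈ range (n + 1), ((a + j) ^ 2 - z ^ 2) =
      (∏ j ∈ range (n + 1), (a + z + j)) * ∏ j ∈ range (n + 1), (a - z + j) := by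
    rw [← prod_mul_distrib]
    exact prod_congr rfl fun j _ => by ring
  have hc : (n : ℂ) ^ (2 * a) = (n : ℂ) ^ (a + z) * (n : ℂ) ^ (a - z) := by
    rw [← Complex.cpow_add _ _ (by exact_mod_cast hn)]
    congr 1; ring
  rw [hp] at h
  calc _ = (n : ℂ) ^ (2 * a) * n.factorial * n.factorial *
        ∑ k ∈ range (n + 1), (-1) ^ k * (2 * (a + k) / ((a + k) ^ 2 - z ^ 2)) /
        (k.factorial * (n - k).factorial * ∏ j ∈ range (n + 1), (2 * a + k + j)) := by
        rw [mul_sum]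
        refine sum_congr rfl fun k hk => ?_
        rw [gammaCoeff_mul_eulerCutoff _ h2a (by have := mem_range.1 hk; omega)]
        ring
    _ = _ := by
        rw [h, hc, Complex.GammaSeq, Complex.GammaSeq, mul_inv]
        ring

/-! ### Growth of the coefficients and control of the cut-off -/

/-- Keeping u.re rather than ‖u‖ in first order is what later yields the sharp exponent w.re instead
of ‖w‖. -/
lemma norm_one_add_le_exp (u : ℂ) : ‖1 + u‖ ≤ Real.exp (u.re + ‖u‖ ^ 2 / 2) := by
  have h1 : ‖1 + u‖ ^ 2 = 1 + (2 * u.re + ‖u‖ ^ 2) := by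
    rw [← Complex.normSq_eq_norm_sq, ← Complex.normSq_eq_norm_sq, Complex.normSq_apply,
      Complex.normSq_apply]
    simp only [Complex.add_re, Complex.add_im, Complex.one_re, Complex.one_im]
    ring
  refine (pow_le_pow_iff_left₀ (norm_nonneg _) (Real.exp_pos _).le two_ne_zero).1 ?_
  rw [h1, ← Real.exp_nat_mul, add_comm]
  refine (Real.add_one_le_exp _).trans (Real.exp_le_exp.2 (le_of_eq ?_))
  push_cast
  ring

lemma sum_one_div_add_one_sq_le (k : ℕ) :
    ∑ j ∈ range k, 1 / ((j : ℝ) + 1) ^ 2 ≤ 2 - 1 / (k : ℝ) := by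
  induction k with
  | zero => norm_num
  | succ k ih =>
    rw [sum_range_succ]
    rcases Nat.eq_zero_or_pos k with rfl | h
    · norm_num
    · have hk : (0 : ℝ) < k := by exact_mod_cast h
      have e : 1 / (k : ℝ) - 1 / ((k : ℝ) + 1) - 1 / ((k : ℝ) + 1) ^ 2 =
          1 / (k * ((k : ℝ) + 1) ^ 2) := by field_simp; ring
      have : 0 < 1 / (k * ((k : ℝ) + 1) ^ 2) := by positivity
      push_cast
      linarith

/-- The first-order terms sum to w.re times a harmonic number, which lies within 1 of log(k+1); the
second-order ones are bounded because ∑ 1/(j+1)² ≤ 2. -/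
lemma norm_prod_one_add_div_le (w : ℂ) (k : ℕ) :
    ‖∏ j ∈ range k, (1 + w / (j + 1))‖ ≤
      Real.exp (‖w‖ + ‖w‖ ^ 2) * ((k : ℝ) + 1) ^ w.re := by
  have hk : (0 : ℝ) < (k : ℝ) + 1 := by positivity
  have hlo := log_add_one_le_harmonic k
  have hhi := harmonic_le_one_add_log k
  have hH : ((harmonic k : ℚ) : ℝ) = ∑ j ∈ range k, 1 / ((j : ℝ) + 1) := by
    simp [harmonic]
  have hlog : Real.log k ≤ Real.log (k + 1) := by
    rcases Nat.eq_zero_or_pos k with rfl | h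
    · simp
    · exact Real.log_le_log (by exact_mod_cast h) (by linarith)
  push_cast at hlo
  rw [hH] at hlo hhi
  set H := ∑ j ∈ range k, 1 / ((j : ℝ) + 1)
  calc ‖∏ j ∈ range k, (1 + w / (j + 1))‖
      ≤ ∏ j ∈ range k, Real.exp (w.re * (1 / ((j : ℝ) + 1)) +
          ‖w‖ ^ 2 / 2 * (1 / ((j : ℝ) + 1) ^ 2)) := by
        rw [norm_prod]
        refine prod_le_prod (fun _ _ => norm_nonneg _) fun j _ => ?_
        refine (norm_one_add_le_exp _).trans (le_of_eq ?_)
        have e : (w / ((j : ℂ) + 1)) = w / ((j + 1 : ℝ) : ℂ) := by push_cast; rfl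
        rw [e, Complex.div_ofReal_re, norm_div, Complex.norm_real, Real.norm_of_nonneg (by positivity)]
        congr 1
        rw [div_pow]
        ring
    _ = Real.exp (w.re * H + ‖w‖ ^ 2 / 2 * ∑ j ∈ range k, 1 / ((j : ℝ) + 1) ^ 2) := by
        rw [← Real.exp_sum, sum_add_distrib, ← mul_sum, ← mul_sum]
    _ ≤ Real.exp (‖w‖ + ‖w‖ ^ 2 + Real.log (k + 1) * w.re) := by
        refine Real.exp_le_exp.2 ?_
        have h1 := sum_one_div_add_one_sq_le k
        have h2 : (0 : ℝ) ≤ 1 / (k : ℝ) := by positivity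
        have h3 : w.re * (H - Real.log (k + 1)) ≤ ‖w‖ := by
          refine (le_abs_self _).trans ?_
          rw [abs_mul]
          have : |H - Real.log (k + 1)| ≤ 1 := abs_le.2 ⟨by linarith, by linarith⟩
          nlinarith [Complex.abs_re_le_norm w, abs_nonneg w.re, norm_nonneg w]
        nlinarith [sq_nonneg ‖w‖]
    _ = _ := by rw [Real.exp_add, Real.rpow_def_of_pos hk]

lemma norm_gammaCoeff_le (s : ℂ) (hs : ∀ m : ℕ, s ≠ -(m : ℂ)) (k : ℕ) :
    ‖gammaCoeff s k‖ ≤ ‖Complex.Gamma s‖ * Real.exp (‖s - 1‖ + ‖s - 1‖ ^ 2) *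
      ((k : ℝ) + 1) ^ (s.re - 1) := by
  have h : gammaCoeff s k = Complex.Gamma s * ∏ j ∈ range k, (1 + (s - 1) / (j + 1)) := by
    induction k with
    | zero => simp [gammaCoeff]
    | succ k ih =>
      rw [gammaCoeff_succ s hs, ih, prod_range_succ, mul_assoc]
      have h1 : (k : ℂ) + 1 ≠ 0 := by exact_mod_cast k.succ_ne_zero
      congr 2
      field_simp
      ring
  rw [h, norm_mul, mul_assoc]
  exact mul_le_mul_of_nonneg_left (by simpa using norm_prod_one_add_div_le (s - 1) k)
    (norm_nonneg _)

lemma tendsto_eulerCutoff (s : ℂ) (hs : ∀ m : ℕ, s ≠ -(m : ℂ)) (k : ℕ) :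
    Tendsto (fun n => eulerCutoff s n k) atTop (𝓝 1) := by
  induction k with
  | zero =>
    have h := (Complex.GammaSeq_tendsto_Gamma s).div_const (Complex.Gamma s)
    rw [div_self (Complex.Gamma_ne_zero hs)] at h
    simpa [eulerCutoff] using h
  | succ k ih =>
    simp_rw [eulerCutoff_succ]
    rw [← mul_one (1 : ℂ)]
    refine ih.mul ?_
    have h := tendsto_add_mul_div_add_mul_atTop_nhds (-(k : ℂ)) (s + k + 1) 1 one_ne_zero
    rw [div_one] at h
    exact h.congr fun n => by congr 1 <;> ring

/-- The weight 1 + k²/n records decay of the cut-off beyond k ≈ √n, without which its variation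
could not be bounded by a multiple of 1/(k+1). For s = 0 each new factor does not increase the
weighted product (`e2`); a general s costs at most exp(2‖s‖/n) per factor (`e1`). -/
lemma norm_prod_cutoff_le (s : ℂ) {n k : ℕ} (hn : 0 < n) (hsn : 2 * ‖s‖ ≤ n) (hk : k ≤ n) :
    ‖∏ j ∈ range k, (((n : ℂ) - j) / (s + n + j + 1))‖ * (1 + (k : ℝ) ^ 2 / n) ≤
      Real.exp (2 * ‖s‖ / n * k) := by
  have hn' : (0 : ℝ) < n := by exact_mod_cast hn
  induction k with
  | zero => simp
  | succ k ih =>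
    have ih := ih (by omega)
    have hkn : (k : ℝ) + 1 ≤ n := by exact_mod_cast hk
    have hd : (n : ℝ) + k + 1 - ‖s‖ ≤ ‖s + n + k + 1‖ := by
      have h1 : s + n + k + 1 = ((n + k + 1 : ℕ) : ℂ) - (-s) := by push_cast; ring
      have h2 := norm_sub_norm_le ((n + k + 1 : ℕ) : ℂ) (-s)
      rw [← h1, norm_neg, Complex.norm_natCast] at h2
      push_cast at h2
      exact h2
    have hpos : (0 : ℝ) < (n : ℝ) + k + 1 - ‖s‖ := by
      have : (0 : ℝ) ≤ k := by positivity
      linarith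
    have hfac : ‖((n : ℂ) - k) / (s + n + k + 1)‖ * (1 + ((k : ℝ) + 1) ^ 2 / n) ≤
        Real.exp (2 * ‖s‖ / n) * (1 + (k : ℝ) ^ 2 / n) := by
      have hnum : ‖(n : ℂ) - k‖ = (n : ℝ) - k := by
        rw [← Nat.cast_sub (by omega), Complex.norm_natCast, Nat.cast_sub (by omega)]
      rw [norm_div, hnum]
      have hk0 : (0 : ℝ) ≤ k := by positivity
      have e1 : ((n : ℝ) - k) / ‖s + n + k + 1‖ ≤ ((n : ℝ) - k) / (n + k + 1) *
          Real.exp (2 * ‖s‖ / n) := by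
        rw [div_mul_eq_mul_div, div_le_div_iff₀ (by linarith) (by positivity), mul_assoc]
        refine mul_le_mul_of_nonneg_left ?_ (by linarith)
        have h3 : 1 + 2 * ‖s‖ / n ≤ Real.exp (2 * ‖s‖ / n) := by
          have := Real.add_one_le_exp (2 * ‖s‖ / n); linarith
        refine le_trans ?_ (mul_le_mul h3 hd hpos.le (Real.exp_pos _).le)
        have h4 : (1 + 2 * ‖s‖ / n) * ((n : ℝ) + k + 1 - ‖s‖) - ((n : ℝ) + k + 1) =
          ‖s‖ / n * (n - 2 * ‖s‖ + 2 * (k + 1)) := by field_simp; ring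
        have h5 : 0 ≤ ‖s‖ / n * (n - 2 * ‖s‖ + 2 * (k + 1)) :=
          mul_nonneg (by positivity) (by linarith)
        linarith
      have e2 : ((n : ℝ) - k) / (n + k + 1) * (1 + ((k : ℝ) + 1) ^ 2 / n) ≤
          1 + (k : ℝ) ^ 2 / n := by
        have h6 : 1 + (k : ℝ) ^ 2 / n - ((n : ℝ) - k) / (n + k + 1) * (1 + ((k : ℝ) + 1) ^ 2 / n) =
            (k ^ 3 + k ^ 2 + k * (k + 1) ^ 2) / (n * (n + k + 1)) := by field_simp; ring
        have h7 : 0 ≤ ((k : ℝ) ^ 3 + k ^ 2 + k * (k + 1) ^ 2) / (n * (n + k + 1)) := by positivity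
        linarith
      calc _ ≤ ((n : ℝ) - k) / (n + k + 1) * Real.exp (2 * ‖s‖ / n) *
            (1 + ((k : ℝ) + 1) ^ 2 / n) := mul_le_mul_of_nonneg_right e1 (by positivity)
        _ = Real.exp (2 * ‖s‖ / n) * (((n : ℝ) - k) / (n + k + 1) *
            (1 + ((k : ℝ) + 1) ^ 2 / n)) := by ring
        _ ≤ _ := mul_le_mul_of_nonneg_left e2 (Real.exp_pos _).le
    rw [prod_range_succ, norm_mul, mul_assoc]
    push_cast
    calc _ ≤ ‖∏ j ∈ range k, (((n : ℂ) - j) / (s + n + j + 1))‖ *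
          (Real.exp (2 * ‖s‖ / n) * (1 + (k : ℝ) ^ 2 / n)) :=
          mul_le_mul_of_nonneg_left hfac (norm_nonneg _)
      _ = (‖∏ j ∈ range k, (((n : ℂ) - j) / (s + n + j + 1))‖ * (1 + (k : ℝ) ^ 2 / n)) *
          Real.exp (2 * ‖s‖ / n) := by ring
      _ ≤ Real.exp (2 * ‖s‖ / n * k) * Real.exp (2 * ‖s‖ / n) :=
          mul_le_mul_of_nonneg_right ih (Real.exp_pos _).le
      _ = _ := by rw [← Real.exp_add]; congr 1; ring

/-- Uniform bounds for the cut-off factor and for its variation. -/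
lemma exists_eulerCutoff_bound (s : ℂ) (hs : ∀ m : ℕ, s ≠ -(m : ℂ)) :
    ∃ B : ℝ, 0 ≤ B ∧ ∀ᶠ n : ℕ in atTop, ∀ k : ℕ, ‖eulerCutoff s n k‖ ≤ B ∧
      ‖eulerCutoff s n k - (s + k) / (k + 1) * eulerCutoff s n (k + 1)‖ ≤ B / (k + 1) := by
  set m := ‖s‖ with hm
  have hm0 : 0 ≤ m := norm_nonneg s
  -- The 2 bounds the cut-off at k = 0 for large n; the exponential bounds exp(2‖s‖k/n) for k ≤ n.
  set D := 2 * Real.exp (2 * m)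
  have hD : 0 < D := by positivity
  refine ⟨2 * (4 + 3 * m) * D, by positivity, ?_⟩
  have hlim : ∀ᶠ n : ℕ in atTop, ‖eulerCutoff s n 0‖ ≤ 2 := by
    have h := (tendsto_eulerCutoff s hs 0).norm
    rw [norm_one] at h
    exact (h.eventually (gt_mem_nhds one_lt_two)).mono fun n hn => hn.le
  have hlarge : ∀ᶠ n : ℕ in atTop, 2 * m ≤ n :=
    tendsto_natCast_atTop_atTop.eventually (eventually_ge_atTop _)
  filter_upwards [hlim, hlarge, eventually_gt_atTop 0] with n hn0 hn1 hn k
  have hn' : (1 : ℝ) ≤ n := by exact_mod_cast hn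
  have hk0 : (0 : ℝ) ≤ k := by positivity
  rcases lt_or_ge n k with hk | hk
  · rw [eulerCutoff_eq_zero s hk, eulerCutoff_eq_zero s (by omega : n < k + 1)]
    simp only [norm_zero, mul_zero, sub_zero]
    constructor <;> positivity
  have hE : ‖eulerCutoff s n k‖ * (1 + (k : ℝ) ^ 2 / n) ≤ D := by
    have h1 := norm_prod_cutoff_le s hn hn1 hk
    have h2 : Real.exp (2 * ‖s‖ / n * k) ≤ Real.exp (2 * m) := by
      refine Real.exp_le_exp.2 ?_
      rw [div_mul_eq_mul_div, div_le_iff₀ (by linarith)]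
      exact mul_le_mul_of_nonneg_left (by exact_mod_cast hk) (by positivity)
    simp only [eulerCutoff, prod_range_zero, mul_one] at hn0
    rw [eulerCutoff, norm_mul, mul_assoc]
    exact mul_le_mul hn0 (h1.trans h2) (by positivity) (by norm_num)
  constructor
  · have : ‖eulerCutoff s n k‖ * 1 ≤ ‖eulerCutoff s n k‖ * (1 + (k : ℝ) ^ 2 / n) :=
      mul_le_mul_of_nonneg_left (by have : 0 ≤ (k : ℝ) ^ 2 / n := by positivity
                                    linarith) (norm_nonneg _)
    nlinarith
  · have hs' : s + n + k + 1 ≠ 0 := fun h => hs (n + k + 1) (by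
      push_cast; linear_combination h)
    have hk1 : (k : ℂ) + 1 ≠ 0 := by exact_mod_cast k.succ_ne_zero
    -- The n² and nk terms cancel in the numerator, leaving O(n + k²) over (k+1)n, that is O((1 +
    -- k²/n)/(k+1)); the weight in `hE` absorbs 1 + k²/n.
    have hid : eulerCutoff s n k - (s + k) / (k + 1) * eulerCutoff s n (k + 1) =
        eulerCutoff s n k * ((n * (1 - s) + (2 * k + 1) * s + (2 * k ^ 2 + 2 * k + 1)) /
          ((k + 1) * (s + n + k + 1))) := by
      rw [eulerCutoff_succ]
      field_simp
      ring
    have hnum : ‖(n * (1 - s) + (2 * k + 1) * s + (2 * k ^ 2 + 2 * k + 1) : ℂ)‖ ≤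
        (4 + 3 * m) * (n + k ^ 2) := by
      have t1 : ‖(n * (1 - s) : ℂ)‖ ≤ n * (1 + m) := by
        rw [norm_mul, Complex.norm_natCast]
        exact mul_le_mul_of_nonneg_left ((norm_sub_le _ _).trans (by simp [hm])) (by linarith)
      have t2 : ‖((2 * k + 1) * s : ℂ)‖ = (2 * k + 1) * m := by
        rw [norm_mul, show (2 * k + 1 : ℂ) = ((2 * k + 1 : ℕ) : ℂ) by push_cast; rfl,
          Complex.norm_natCast]
        push_cast; rfl
      have t3 : ‖(2 * k ^ 2 + 2 * k + 1 : ℂ)‖ = 2 * k ^ 2 + 2 * k + 1 := by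
        rw [show (2 * k ^ 2 + 2 * k + 1 : ℂ) = ((2 * k ^ 2 + 2 * k + 1 : ℕ) : ℂ) by
          push_cast; rfl, Complex.norm_natCast]
        push_cast; rfl
      refine (norm_add₃_le).trans ?_
      rw [t2, t3]
      have q : 0 ≤ ((k : ℝ) - 1) ^ 2 := sq_nonneg _
      have q1 : (2 * k + 1 : ℝ) ≤ 2 * (n + k ^ 2) := by nlinarith
      have q2 : (2 * k ^ 2 + 2 * k + 1 : ℝ) ≤ 3 * (n + k ^ 2) := by nlinarith
      have q3 : (n : ℝ) * (1 + m) ≤ (n + k ^ 2) * (1 + m) :=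
        mul_le_mul_of_nonneg_right (by nlinarith) (by linarith)
      have q4 := mul_le_mul_of_nonneg_right q1 hm0
      nlinarith
    have hden : (n : ℝ) / 2 ≤ ‖s + n + k + 1‖ := by
      have h1 : s + n + k + 1 = ((n + k + 1 : ℕ) : ℂ) - (-s) := by push_cast; ring
      have h2 := norm_sub_norm_le ((n + k + 1 : ℕ) : ℂ) (-s)
      rw [← h1, norm_neg, Complex.norm_natCast] at h2
      push_cast at h2
      linarith
    have hk1' : ‖(k : ℂ) + 1‖ = k + 1 := by
      rw [show (k : ℂ) + 1 = ((k + 1 : ℕ) : ℂ) by push_cast; rfl, Complex.norm_natCast]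
      push_cast; rfl
    rw [hid, norm_mul, norm_div, norm_mul, hk1']
    calc _ ≤ ‖eulerCutoff s n k‖ * ((4 + 3 * m) * (n + k ^ 2) / ((k + 1) * (n / 2))) := by
          gcongr
      _ = (‖eulerCutoff s n k‖ * (1 + (k : ℝ) ^ 2 / n)) * (2 * (4 + 3 * m) / (k + 1)) := by
          field_simp
      _ ≤ D * (2 * (4 + 3 * m) / (k + 1)) :=
          mul_le_mul_of_nonneg_right hE (by positivity)
      _ = _ := by ring

/-! ### Decay of the kernel, its differences and its derivative -/

/-- `1 / (x - z) + 1 / (x + z) - 2 / x`. -/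
noncomputable def poleKernel (z x : ℂ) : ℂ := 2 * z ^ 2 / (x * (x - z) * (x + z))

/-- The negative of the derivative of `poleKernel z`. -/
noncomputable def poleKernelNegDeriv (z x : ℂ) : ℂ :=
  1 / (x - z) ^ 2 + 1 / (x + z) ^ 2 - 2 / x ^ 2

section KernelBounds

variable {z x : ℂ} {c K M : ℝ}

lemma norm_poleKernel_le (hc : 0 < c) (hK : 0 < K) (h0 : c * K ≤ ‖x‖) (hm : c * K ≤ ‖x - z‖)
    (hp : c * K ≤ ‖x + z‖) : ‖poleKernel z x‖ ≤ 2 * ‖z‖ ^ 2 / c ^ 3 / K ^ 3 := by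
  have hcK : 0 < c * K := mul_pos hc hK
  rw [poleKernel, norm_div, norm_mul, norm_mul, norm_mul, norm_pow, Complex.norm_two, div_div]
  have : c ^ 3 * K ^ 3 = c * K * (c * K) * (c * K) := by ring
  rw [this]
  gcongr

/-- Over the common denominator of degree 6 in x, the numerator has degree only 2: a unit step gains
one power of K over the kernel itself. -/
lemma norm_poleKernel_sub_le (hc : 0 < c) (hK : 1 ≤ K) (h0 : c * K ≤ ‖x‖)
    (hm : c * K ≤ ‖x - z‖) (hp : c * K ≤ ‖x + z‖) (h0' : c * K ≤ ‖x + 1‖)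
    (hm' : c * K ≤ ‖x + 1 - z‖) (hp' : c * K ≤ ‖x + 1 + z‖) (hM : ‖x‖ ≤ M * K) (hM0 : 0 ≤ M) :
    ‖poleKernel z x - poleKernel z (x + 1)‖ ≤
      2 * ‖z‖ ^ 2 * (3 * M ^ 2 + 3 * M + 1 + ‖z‖ ^ 2) / c ^ 6 / K ^ 4 := by
  have hK0 : 0 < K := by linarith
  have hcK : 0 < c * K := mul_pos hc hK0
  have ne {y : ℂ} (h : c * K ≤ ‖y‖) : y ≠ 0 := norm_pos_iff.1 (hcK.trans_le h)
  have n1 := ne h0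
  have n2 := ne hm
  have n3 := ne hp
  have n4 := ne h0'
  have n5 := ne hm'
  have n6 := ne hp'
  have e : poleKernel z x - poleKernel z (x + 1) = 2 * z ^ 2 * (3 * x ^ 2 + 3 * x + 1 - z ^ 2) /
      ((x * (x - z) * (x + z)) * ((x + 1) * (x + 1 - z) * (x + 1 + z))) := by
    rw [poleKernel, poleKernel]
    field_simp
    ring
  have hnum : ‖3 * x ^ 2 + 3 * x + 1 - z ^ 2‖ ≤ (3 * M ^ 2 + 3 * M + 1 + ‖z‖ ^ 2) * K ^ 2 := by
    have t : ‖3 * x ^ 2 + 3 * x + 1 - z ^ 2‖ ≤ 3 * ‖x‖ ^ 2 + 3 * ‖x‖ + 1 + ‖z‖ ^ 2 := by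
      refine (norm_sub_le _ _).trans ?_
      refine (add_le_add_left norm_add₃_le _).trans ?_
      simp
    have hx2 : ‖x‖ ^ 2 ≤ (M * K) ^ 2 := by gcongr
    have hK2 : 1 ≤ K ^ 2 := by nlinarith
    have hK3 : K ≤ K ^ 2 := by nlinarith
    have hMK : M * K ≤ M * K ^ 2 := mul_le_mul_of_nonneg_left hK3 hM0
    have hzK : ‖z‖ ^ 2 * 1 ≤ ‖z‖ ^ 2 * K ^ 2 := mul_le_mul_of_nonneg_left hK2 (by positivity)
    nlinarith
  have hden : c ^ 6 * K ^ 6 = (c * K * (c * K) * (c * K)) * (c * K * (c * K) * (c * K)) := by ring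
  calc _ ≤ 2 * ‖z‖ ^ 2 * ((3 * M ^ 2 + 3 * M + 1 + ‖z‖ ^ 2) * K ^ 2) / (c ^ 6 * K ^ 6) := by
        rw [e, hden]
        simp only [norm_div, norm_mul, norm_pow, Complex.norm_two]
        gcongr
    _ = _ := by field_simp

lemma norm_poleKernelNegDeriv_le (hc : 0 < c) (hK : 1 ≤ K) (h0 : c * K ≤ ‖x‖)
    (hm : c * K ≤ ‖x - z‖) (hp : c * K ≤ ‖x + z‖) (hM : ‖x‖ ≤ M * K) :
    ‖poleKernelNegDeriv z x‖ ≤ 2 * ‖z‖ ^ 2 * (3 * M ^ 2 + ‖z‖ ^ 2) / c ^ 6 / K ^ 4 := by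
  have hK0 : 0 < K := by linarith
  have hcK : 0 < c * K := mul_pos hc hK0
  have ne {y : ℂ} (h : c * K ≤ ‖y‖) : y ≠ 0 := norm_pos_iff.1 (hcK.trans_le h)
  have n1 := ne h0
  have n2 := ne hm
  have n3 := ne hp
  have e : poleKernelNegDeriv z x = 2 * z ^ 2 * (3 * x ^ 2 - z ^ 2) /
      ((x * (x - z) * (x + z)) * (x * (x - z) * (x + z))) := by
    rw [poleKernelNegDeriv]
    field_simp
    ring
  have hnum : ‖3 * x ^ 2 - z ^ 2‖ ≤ (3 * M ^ 2 + ‖z‖ ^ 2) * K ^ 2 := by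
    have t : ‖3 * x ^ 2 - z ^ 2‖ ≤ 3 * ‖x‖ ^ 2 + ‖z‖ ^ 2 :=
      (norm_sub_le _ _).trans (by simp)
    have hx2 : ‖x‖ ^ 2 ≤ (M * K) ^ 2 := by gcongr
    have hK2 : 1 ≤ K ^ 2 := by nlinarith
    have hzK : ‖z‖ ^ 2 * 1 ≤ ‖z‖ ^ 2 * K ^ 2 := mul_le_mul_of_nonneg_left hK2 (by positivity)
    nlinarith
  have hden : c ^ 6 * K ^ 6 = (c * K * (c * K) * (c * K)) * (c * K * (c * K) * (c * K)) := by ring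
  calc _ ≤ 2 * ‖z‖ ^ 2 * ((3 * M ^ 2 + ‖z‖ ^ 2) * K ^ 2) / (c ^ 6 * K ^ 6) := by
        rw [e, hden]
        simp only [norm_div, norm_mul, norm_pow, Complex.norm_two]
        gcongr
    _ = _ := by field_simp

end KernelBounds

/-! ### Bounds uniform in a ball around `a` -/

lemma exists_mul_le_norm_add_natCast (b : ℂ) (hb : ∀ k : ℕ, b + k ≠ 0) :
    ∃ c : ℝ, 0 < c ∧ ∀ b' ∈ ball b c, ∀ k : ℕ, c * ((k : ℝ) + 1) ≤ ‖b' + k‖ := by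
  have hlim := tendsto_add_mul_div_add_mul_atTop_nhds (1 : ℂ) b 1 one_ne_zero
  obtain ⟨R, hR⟩ := (isBounded_range_of_tendsto _ hlim).exists_norm_le
  have hR' (k : ℕ) : (k : ℝ) + 1 ≤ R * ‖b + k‖ := by
    have h := hR _ ⟨k, rfl⟩
    simp only [one_mul] at h
    rw [norm_div, div_le_iff₀ (norm_pos_iff.2 (hb k)), add_comm,
      show (k : ℂ) + 1 = ((k + 1 : ℕ) : ℂ) by push_cast; rfl, Complex.norm_natCast] at h
    exact_mod_cast h
  have hR0 : 0 < R := by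
    have h := hR' 0
    by_contra hneg
    have := mul_nonpos_of_nonpos_of_nonneg (not_lt.1 hneg) (norm_nonneg (b + (0 : ℕ)))
    push_cast at *
    linarith
  -- At `b` the bound holds with 1/R; half of it is given up to the displacement b' - b.
  refine ⟨1 / (2 * R), by positivity, fun b' hb' k => ?_⟩
  rw [mem_ball_iff_norm] at hb'
  have h1 : ‖b + k‖ ≤ ‖b' + k‖ + ‖b' - b‖ := by
    have := norm_sub_le (b' + k) (b' - b)
    rwa [show b' + k - (b' - b) = b + k by ring] at this
  have h2 : ((k : ℝ) + 1) / R ≤ ‖b + k‖ := by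
    rw [div_le_iff₀ hR0, mul_comm]; exact hR' k
  have h3 : ((k : ℝ) + 1) / R = 1 / (2 * R) * ((k : ℝ) + 1) + 1 / (2 * R) * ((k : ℝ) + 1) := by
    field_simp; ring
  have h4 : 1 / (2 * R) * 1 ≤ 1 / (2 * R) * ((k : ℝ) + 1) :=
    mul_le_mul_of_nonneg_left (by have : (0 : ℝ) ≤ k := by positivity
                                  linarith) (by positivity)
  linarith

/-- The bounds, with constants `C` and `τ`, on the factors of the series at the point `b`. -/
structure SeriesBounds (z : ℂ) (C τ : ℝ) (b : ℂ) : Prop where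
  two_mul_ne (m : ℕ) : 2 * b ≠ -(m : ℂ)
  ne_zero (k : ℕ) : b + k ≠ 0
  sub_ne_zero (k : ℕ) : b + k - z ≠ 0
  add_ne_zero (k : ℕ) : b + k + z ≠ 0
  norm_le : ‖2 * b - 1‖ ≤ C
  coeff_le (k : ℕ) : ‖gammaCoeff (2 * b) k‖ ≤ C * ((k : ℝ) + 1) ^ τ
  kernel_le (k : ℕ) : ‖poleKernel z (b + k)‖ ≤ C / ((k : ℝ) + 1) ^ 3
  kernel_sub_le (k : ℕ) :
    ‖poleKernel z (b + k) - poleKernel z (b + k + 1)‖ ≤ C / ((k : ℝ) + 1) ^ 4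
  kernelNegDeriv_le (k : ℕ) : ‖poleKernelNegDeriv z (b + k)‖ ≤ C / ((k : ℝ) + 1) ^ 4

lemma exists_ball_seriesBounds (a z : ℂ) (ha : a.re < 2) (h2a : ∀ m : ℕ, 2 * a ≠ -(m : ℂ))
    (hm : ∀ k : ℕ, a - z + k ≠ 0) (hp : ∀ k : ℕ, a + z + k ≠ 0) :
    ∃ ε C τ : ℝ, 0 < ε ∧ 0 ≤ C ∧ τ < 3 ∧ ∀ b ∈ ball a ε, SeriesBounds z C τ b := by
  have h2a' (k : ℕ) : 2 * a + k ≠ 0 := fun h => h2a k (eq_neg_of_add_eq_zero_left h)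
  have ha0 (k : ℕ) : a + k ≠ 0 := fun h => h2a' (2 * k) (by
    push_cast; linear_combination 2 * h)
  obtain ⟨c₀, hc₀, H₀⟩ := exists_mul_le_norm_add_natCast a ha0
  obtain ⟨c₁, hc₁, H₁⟩ := exists_mul_le_norm_add_natCast _ hm
  obtain ⟨c₂, hc₂, H₂⟩ := exists_mul_le_norm_add_natCast _ hp
  obtain ⟨c₃, hc₃, H₃⟩ := exists_mul_le_norm_add_natCast _ h2a'
  have hcont : ContinuousAt (fun b : ℂ => Complex.Gamma (2 * b)) a :=
    ContinuousAt.comp (f := fun b : ℂ => 2 * b) (g := Complex.Gamma)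
      (Complex.differentiableAt_Gamma _ h2a).continuousAt (by fun_prop)
  obtain ⟨δ, hδ, Hδ⟩ := Metric.eventually_nhds_iff_ball.1
    (hcont.norm.eventually (gt_mem_nhds (lt_add_one ‖Complex.Gamma (2 * a)‖)))
  set c := min c₀ (min c₁ c₂)
  have hc : 0 < c := lt_min hc₀ (lt_min hc₁ hc₂)
  -- c₃ is halved because 2b moves twice as fast as b; δ keeps Γ(2b) bounded; the last entry keeps
  -- the exponent 2(Re a + ε) - 1 below 3.
  set ε := min c (min (c₃ / 2) (min δ (min 1 ((2 - a.re) / 2))))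
  have hε : 0 < ε := lt_min hc (lt_min (by linarith) (lt_min hδ (lt_min one_pos (by linarith))))
  set M := ‖a‖ + 2
  set S := 2 * ‖a‖ + 3
  set G := (‖Complex.Gamma (2 * a)‖ + 1) * Real.exp (S + S ^ 2)
  set C₁ := 2 * ‖z‖ ^ 2 / c ^ 3
  set C₂ := 2 * ‖z‖ ^ 2 * (3 * M ^ 2 + 3 * M + 1 + ‖z‖ ^ 2) / c ^ 6
  set C₃ := 2 * ‖z‖ ^ 2 * (3 * M ^ 2 + ‖z‖ ^ 2) / c ^ 6
  have hM : 0 ≤ M := by positivity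
  have hS : 0 ≤ S := by positivity
  have hG : 0 ≤ G := by positivity
  have hC₁ : 0 ≤ C₁ := by positivity
  have hC₂ : 0 ≤ C₂ := by positivity
  have hC₃ : 0 ≤ C₃ := by positivity
  refine ⟨ε, S + G + C₁ + C₂ + C₃, 2 * (a.re + ε) - 1, hε, by positivity, ?_, fun b hb => ?_⟩
  · have : ε ≤ (2 - a.re) / 2 := (min_le_right _ _).trans ((min_le_right _ _).trans
      ((min_le_right _ _).trans (min_le_right _ _)))
    have h' : ε < 2 - a.re := by linarith
    linarith
  have hb' := mem_ball_iff_norm.1 hb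
  have hbc : ‖b - a‖ < c := hb'.trans_le (min_le_left _ _)
  have hbc₃ : ‖b - a‖ < c₃ / 2 := hb'.trans_le ((min_le_right _ _).trans (min_le_left _ _))
  have hbδ : ‖b - a‖ < δ := hb'.trans_le ((min_le_right _ _).trans ((min_le_right _ _).trans
    (min_le_left _ _)))
  have hb1 : ‖b - a‖ < 1 := hb'.trans_le ((min_le_right _ _).trans ((min_le_right _ _).trans
    ((min_le_right _ _).trans (min_le_left _ _))))
  have hcc₀ : c ≤ c₀ := min_le_left _ _
  have hcc₁ : c ≤ c₁ := (min_le_right _ _).trans (min_le_left _ _)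
  have hcc₂ : c ≤ c₂ := (min_le_right _ _).trans (min_le_right _ _)
  have hK (k : ℕ) : (1 : ℝ) ≤ (k : ℝ) + 1 := by
    have : (0 : ℝ) ≤ k := by positivity
    linarith
  have L₀ (k : ℕ) : c * ((k : ℝ) + 1) ≤ ‖b + k‖ :=
    (mul_le_mul_of_nonneg_right hcc₀ (by positivity)).trans
      (H₀ b (mem_ball_iff_norm.2 (hbc.trans_le hcc₀)) k)
  have L₁ (k : ℕ) : c * ((k : ℝ) + 1) ≤ ‖b + k - z‖ := by
    have := H₁ (b - z) (mem_ball_iff_norm.2 (by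
      rw [show b - z - (a - z) = b - a by ring]; exact hbc.trans_le hcc₁)) k
    rw [show b + k - z = b - z + k by ring]
    exact (mul_le_mul_of_nonneg_right hcc₁ (by positivity)).trans this
  have L₂ (k : ℕ) : c * ((k : ℝ) + 1) ≤ ‖b + k + z‖ := by
    have := H₂ (b + z) (mem_ball_iff_norm.2 (by
      rw [show b + z - (a + z) = b - a by ring]; exact hbc.trans_le hcc₂)) k
    rw [show b + k + z = b + z + k by ring]
    exact (mul_le_mul_of_nonneg_right hcc₂ (by positivity)).trans this
  have L₃ (k : ℕ) : c₃ * ((k : ℝ) + 1) ≤ ‖2 * b + k‖ := by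
    refine H₃ (2 * b) (mem_ball_iff_norm.2 ?_) k
    rw [← mul_sub, norm_mul, Complex.norm_two]
    linarith
  have hstep (k : ℕ) : c * ((k : ℝ) + 1) ≤ c * (((k + 1 : ℕ) : ℝ) + 1) := by
    push_cast; nlinarith
  have hsucc (k : ℕ) : b + ((k + 1 : ℕ) : ℂ) = b + k + 1 := by push_cast; ring
  have hbn : ‖b‖ ≤ ‖a‖ + 1 := by
    have := norm_add_le a (b - a)
    rw [add_sub_cancel] at this
    linarith
  have hMk (k : ℕ) : ‖b + k‖ ≤ M * ((k : ℝ) + 1) := by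
    refine (norm_add_le _ _).trans ?_
    rw [Complex.norm_natCast]
    have : (0 : ℝ) ≤ k := by positivity
    nlinarith [norm_nonneg a]
  have pos {y t : ℝ} {w : ℂ} (ht : 0 < t) (h : t * y ≤ ‖w‖) (hy : 1 ≤ y) : w ≠ 0 :=
    norm_pos_iff.1 ((mul_pos ht (by linarith)).trans_le h)
  have hSb : ‖2 * b - 1‖ ≤ S := by
    refine (norm_sub_le _ _).trans ?_
    rw [norm_mul, Complex.norm_two, norm_one]
    linarith
  have h2b (m : ℕ) : 2 * b ≠ -(m : ℂ) := fun h => pos hc₃ (L₃ m) (hK m) (by rw [h]; ring)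
  refine ⟨h2b, fun k => pos hc (L₀ k) (hK k), fun k => pos hc (L₁ k) (hK k),
    fun k => pos hc (L₂ k) (hK k), by linarith, fun k => ?_, fun k => ?_, fun k => ?_, fun k => ?_⟩
  · have hre : b.re ≤ a.re + ε := by
      have h1 := (Complex.abs_re_le_norm (b - a)).trans hb'.le
      have h2 := (le_abs_self _).trans h1
      rw [Complex.sub_re] at h2
      linarith
    have hg : ‖Complex.Gamma (2 * b)‖ ≤ ‖Complex.Gamma (2 * a)‖ + 1 :=
      (Hδ b (mem_ball_iff_norm.2 hbδ)).le
    have hexp : (2 * b).re - 1 ≤ 2 * (a.re + ε) - 1 := by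
      rw [show (2 * b).re = 2 * b.re by simp]
      linarith
    calc _ ≤ _ := norm_gammaCoeff_le _ h2b k
      _ ≤ G * ((k : ℝ) + 1) ^ (2 * (a.re + ε) - 1) := by
        refine mul_le_mul ?_ (Real.rpow_le_rpow_of_exponent_le (hK k) hexp) (by positivity) hG
        exact mul_le_mul hg (Real.exp_le_exp.2 (add_le_add hSb
          (pow_le_pow_left₀ (norm_nonneg _) hSb 2))) (Real.exp_pos _).le (by positivity)
      _ ≤ _ := by
        gcongr
        linarith
  · refine (norm_poleKernel_le hc (by positivity) (L₀ k) (L₁ k) (L₂ k)).trans ?_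
    gcongr
    linarith
  · have := norm_poleKernel_sub_le (M := M) hc (hK k) (L₀ k) (L₁ k) (L₂ k)
      (hsucc k ▸ (hstep k).trans (L₀ (k + 1))) (hsucc k ▸ (hstep k).trans (L₁ (k + 1)))
      (hsucc k ▸ (hstep k).trans (L₂ (k + 1))) (hMk k) hM
    refine this.trans ?_
    gcongr
    linarith
  · refine (norm_poleKernelNegDeriv_le (M := M) hc (hK k) (L₀ k) (L₁ k) (L₂ k) (hMk k)).trans ?_
    gcongr
    linarith

/-! ### Pairing consecutive terms, and the expansion of Γ(b+z)Γ(b-z) -/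

lemma sum_range_two_mul_eq {M : Type*} [AddCommMonoid M] (f : ℕ → M) (N : ℕ) :
    ∑ k ∈ range (2 * N), f k = ∑ j ∈ range N, (f (2 * j) + f (2 * j + 1)) := by
  induction N with
  | zero => simp
  | succ N ih => rw [show 2 * (N + 1) = 2 * N + 1 + 1 by ring, sum_range_succ, sum_range_succ, ih,
      sum_range_succ, add_assoc]

/-- If the terms tend to `0`, ordered partial sums converge as soon as those of even length do. -/
lemma tendsto_sum_range_of_tendsto_sum_pairs {f : ℕ → ℂ} {L : ℂ}
    (h0 : Tendsto f atTop (𝓝 0))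
    (h : Tendsto (fun N => ∑ j ∈ range N, (f (2 * j) + f (2 * j + 1))) atTop (𝓝 L)) :
    Tendsto (fun N => ∑ k ∈ range N, f k) atTop (𝓝 L) := by
  simp_rw [← sum_range_two_mul_eq] at h
  have hdiv : Tendsto (fun N : ℕ => N / 2) atTop atTop :=
    Nat.tendsto_div_const_atTop two_ne_zero
  have hrest : Tendsto (fun N => ∑ k ∈ range N, f k - ∑ k ∈ range (2 * (N / 2)), f k)
      atTop (𝓝 0) := by
    have hlast : Tendsto (fun N => f (N - 1)) atTop (𝓝 0) :=
      h0.comp (tendsto_sub_atTop_nat 1)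
    refine squeeze_zero_norm (fun N => ?_) (tendsto_zero_iff_norm_tendsto_zero.1 hlast)
    rcases Nat.even_or_odd' N with ⟨m, rfl | rfl⟩
    · simp
    · rw [show 2 * ((2 * m + 1) / 2) = 2 * m by omega, sum_range_succ]
      simp
  simpa using (h.comp hdiv).add hrest

/-- The `k`-th term of the expansion of `Γ(b + z) Γ(b - z) - Γ(b)²`. -/
noncomputable def gammaProdTerm (z b : ℂ) (k : ℕ) : ℂ :=
  (-1) ^ k * (gammaCoeff (2 * b) k * poleKernel z (b + k))

lemma summable_two_mul_add_one_rpow {τ : ℝ} (hτ : τ < 3) (B : ℝ) :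
    Summable fun j : ℕ => B * (((2 * j : ℕ) : ℝ) + 1) ^ (τ - 4) := by
  have h := (Real.summable_nat_rpow (p := τ - 4)).2 (by linarith)
  have h2 := h.comp_injective (i := fun j : ℕ => 2 * j + 1) (fun i j hij => by
    have : 2 * i + 1 = 2 * j + 1 := hij
    omega)
  refine (h2.congr fun j => ?_).mul_left B
  simp

/-- Estimate for two consecutive terms of an alternating sum. -/
lemma norm_pair_le {C B K τ : ℝ} {q u u' v v' : ℂ} (hK : 1 ≤ K) (hC : 0 ≤ C)
    (hB : 0 ≤ B) (hq : ‖q‖ ≤ C * K ^ τ) (hu : ‖u - u'‖ ≤ C / K ^ 4) (hu' : ‖u'‖ ≤ C / K ^ 3)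
    (hv : ‖v‖ ≤ B) (hv' : ‖v - v'‖ ≤ B / K) :
    ‖q * (v * u) - q * (v' * u')‖ ≤ 2 * B * C ^ 2 * K ^ (τ - 4) := by
  have hK0 : 0 < K := by linarith
  have e : q * (v * u) - q * (v' * u') = q * (v * (u - u') + (v - v') * u') := by ring
  have h1 : ‖v * (u - u') + (v - v') * u'‖ ≤ 2 * B * C / K ^ 4 := by
    refine (norm_add_le _ _).trans ?_
    rw [norm_mul, norm_mul]
    calc _ ≤ B * (C / K ^ 4) + B / K * (C / K ^ 3) := by gcongr
      _ = _ := by field_simp; ring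
  rw [e, norm_mul]
  calc _ ≤ C * K ^ τ * (2 * B * C / K ^ 4) := by gcongr
    _ = _ := by
      rw [Real.rpow_sub hK0, show (4 : ℝ) = ((4 : ℕ) : ℝ) by norm_num, Real.rpow_natCast]
      ring

namespace SeriesBounds

variable {z b : ℂ} {C τ : ℝ}

lemma norm_gammaProdTerm_le (h : SeriesBounds z C τ b) (k : ℕ) :
    ‖gammaProdTerm z b k‖ ≤ C ^ 2 * ((k : ℝ) + 1) ^ (τ - 3) := by
  have hk : (0 : ℝ) < (k : ℝ) + 1 := by positivity
  rw [gammaProdTerm, norm_mul, norm_pow, norm_neg, norm_one, one_pow, one_mul, norm_mul]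
  have hC : 0 ≤ C := (norm_nonneg _).trans h.norm_le
  calc _ ≤ C * ((k : ℝ) + 1) ^ τ * (C / ((k : ℝ) + 1) ^ 3) :=
        mul_le_mul (h.coeff_le k) (h.kernel_le k) (norm_nonneg _) (by positivity)
    _ = _ := by
      rw [Real.rpow_sub hk, show (3 : ℝ) = ((3 : ℕ) : ℝ) by norm_num, Real.rpow_natCast]
      ring

lemma kernel_succ_le (h : SeriesBounds z C τ b) (k : ℕ) :
    ‖poleKernel z (b + k + 1)‖ ≤ C / ((k : ℝ) + 1) ^ 3 := by
  have h1 := h.kernel_le (k + 1)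
  push_cast at h1
  rw [← add_assoc] at h1
  have hC : 0 ≤ C := (norm_nonneg _).trans h.norm_le
  refine h1.trans ?_
  gcongr
  linarith

/-- Without cut-off, v = 1 and v' is the ratio (2b+k)/(k+1) of successive coefficients, which
differs from 1 by (2b-1)/(k+1) in norm. -/
lemma norm_gammaProdTerm_pair_le (h : SeriesBounds z C τ b) (j : ℕ) :
    ‖gammaProdTerm z b (2 * j) + gammaProdTerm z b (2 * j + 1)‖ ≤
      2 * (1 + C) * C ^ 2 * (((2 * j : ℕ) : ℝ) + 1) ^ (τ - 4) := by
  have hC : 0 ≤ C := (norm_nonneg _).trans h.norm_le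
  have hK : (1 : ℝ) ≤ ((2 * j : ℕ) : ℝ) + 1 := by
    have : (0 : ℝ) ≤ ((2 * j : ℕ) : ℝ) := by positivity
    linarith
  have hk1 : ((2 * j : ℕ) : ℂ) + 1 ≠ 0 := by exact_mod_cast (2 * j).succ_ne_zero
  have hn : ‖((2 * j : ℕ) : ℂ) + 1‖ = ((2 * j : ℕ) : ℝ) + 1 := by
    rw [← Nat.cast_succ, Complex.norm_natCast, Nat.cast_succ]
  have hv : ‖(1 : ℂ) - (2 * b + (2 * j : ℕ)) / ((2 * j : ℕ) + 1)‖ ≤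
      (1 + C) / (((2 * j : ℕ) : ℝ) + 1) := by
    have e : (1 : ℂ) - (2 * b + (2 * j : ℕ)) / ((2 * j : ℕ) + 1) =
        -((2 * b - 1) / ((2 * j : ℕ) + 1)) := by
      field_simp; ring
    rw [e, norm_neg, norm_div, hn]
    gcongr
    linarith [h.norm_le]
  refine le_trans (le_of_eq ?_) (norm_pair_le hK hC (by linarith) (h.coeff_le (2 * j))
    (h.kernel_sub_le (2 * j)) (h.kernel_succ_le (2 * j)) (v := 1) (by rw [norm_one]; linarith) hv)
  congr 1
  rw [gammaProdTerm, gammaProdTerm, gammaCoeff_succ _ h.two_mul_ne, pow_succ, pow_mul]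
  push_cast
  rw [add_assoc]
  norm_num
  ring

/-- Expansion of `Γ(b + z) Γ(b - z) - Γ(b)²`, with consecutive terms grouped in pairs. -/
lemma hasSum_gammaProdTerm_pair (hτ : τ < 3) (h : SeriesBounds z C τ b) :
    HasSum (fun j => gammaProdTerm z b (2 * j) + gammaProdTerm z b (2 * j + 1))
      (Complex.Gamma (b + z) * Complex.Gamma (b - z) - Complex.Gamma b ^ 2) := by
  have hC : 0 ≤ C := (norm_nonneg _).trans h.norm_le
  have hsum : Summable fun j => gammaProdTerm z b (2 * j) + gammaProdTerm z b (2 * j + 1) :=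
    Summable.of_norm_bounded (summable_two_mul_add_one_rpow hτ _) h.norm_gammaProdTerm_pair_le
  obtain ⟨B, hB, hcut⟩ := exists_eulerCutoff_bound (2 * b) h.two_mul_ne
  set f : ℕ → ℕ → ℂ := fun n k => gammaProdTerm z b k * eulerCutoff (2 * b) n k
  -- Tannery's theorem applied to the pairs: the individual terms need not have a summable majorant.
  have hlim := tendsto_tsum_of_dominated_convergence (𝓕 := atTop)
    (f := fun n j => f n (2 * j) + f n (2 * j + 1))
    (g := fun j => gammaProdTerm z b (2 * j) + gammaProdTerm z b (2 * j + 1))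
    (summable_two_mul_add_one_rpow hτ (2 * B * C ^ 2))
    (fun j => by
      have t (k : ℕ) := (tendsto_eulerCutoff (2 * b) h.two_mul_ne k).const_mul (gammaProdTerm z b k)
      simpa using (t (2 * j)).add (t (2 * j + 1)))
    (by
      filter_upwards [hcut] with n hn j
      have hK : (1 : ℝ) ≤ ((2 * j : ℕ) : ℝ) + 1 := by
        have : (0 : ℝ) ≤ ((2 * j : ℕ) : ℝ) := by positivity
        linarith
      refine le_trans (le_of_eq ?_) (norm_pair_le hK hC hB (h.coeff_le (2 * j))
        (h.kernel_sub_le (2 * j)) (h.kernel_succ_le (2 * j)) (hn (2 * j)).1 (hn (2 * j)).2)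
      congr 1
      simp only [f]
      rw [gammaProdTerm, gammaProdTerm, gammaCoeff_succ _ h.two_mul_ne, pow_succ, pow_mul]
      push_cast
      rw [add_assoc b]
      norm_num
      ring)
  have hseq : Tendsto (fun n => Complex.GammaSeq (b + z) n * Complex.GammaSeq (b - z) n -
      Complex.GammaSeq b n ^ 2) atTop
      (𝓝 (Complex.Gamma (b + z) * Complex.Gamma (b - z) - Complex.Gamma b ^ 2)) :=
    ((Complex.GammaSeq_tendsto_Gamma _).mul (Complex.GammaSeq_tendsto_Gamma _)).sub
      ((Complex.GammaSeq_tendsto_Gamma _).pow 2)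
  have heq : ∀ᶠ n : ℕ in atTop, Complex.GammaSeq (b + z) n * Complex.GammaSeq (b - z) n -
      Complex.GammaSeq b n ^ 2 = ∑' j, (f n (2 * j) + f n (2 * j + 1)) := by
    filter_upwards [eventually_gt_atTop 0] with n hn
    have hz (k : ℕ) : (b + k) ^ 2 ≠ z ^ 2 := fun e => by
      have : (b + k - z) * (b + k + z) = 0 := by linear_combination e
      rcases mul_eq_zero.1 this with e | e
      exacts [h.sub_ne_zero k e, h.add_ne_zero k e]
    have h1 := sum_gammaCoeff_mul_eulerCutoff b z h.two_mul_ne hz hn.ne'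
    have h0 := sum_gammaCoeff_mul_eulerCutoff b 0 h.two_mul_ne
      (fun k => by simpa using h.ne_zero k) hn.ne'
    rw [add_zero, sub_zero, ← pow_two] at h0
    -- The first n + 1 pairs cover 2(n + 1) indices; those above n contribute nothing, since the
    -- cut-off vanishes there.
    rw [← h1, ← h0, ← sum_sub_distrib, tsum_eq_sum (s := range (n + 1)) (fun j hj => ?_),
      ← sum_range_two_mul_eq]
    · symm
      rw [← sum_subset (s₁ := range (n + 1)) (range_mono (by omega)) (fun k _ hk => ?_)]
      · refine sum_congr rfl fun k _ => ?_
        have n0 := h.ne_zero k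
        have n1 := h.sub_ne_zero k
        have n2 := h.add_ne_zero k
        have n3 : (b + k) ^ 2 - z ^ 2 ≠ 0 := sub_ne_zero_of_ne (hz k)
        have e : poleKernel z (b + k) = 2 * (b + k) / ((b + k) ^ 2 - z ^ 2) -
            2 * (b + k) / ((b + k) ^ 2 - 0 ^ 2) := by
          rw [poleKernel, mul_assoc, show (b + k - z) * (b + k + z) = (b + k) ^ 2 - z ^ 2 by ring,
            zero_pow two_ne_zero, sub_zero]
          field_simp
          ring
        simp only [f]
        rw [gammaProdTerm, e]
        ring
      · simp only [mem_range, not_lt] at hk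
        simp only [f]
        rw [eulerCutoff_eq_zero _ (by omega), mul_zero]
    · simp only [mem_range, not_lt] at hj
      simp only [f]
      rw [eulerCutoff_eq_zero _ (by omega), eulerCutoff_eq_zero _ (by omega), mul_zero, mul_zero,
        add_zero]
  rw [tendsto_nhds_unique (hseq.congr' heq) hlim]
  exact hsum.hasSum

end SeriesBounds

/-! ### Termwise differentiation in the parameter -/

lemma hasDerivAt_Gamma (s : ℂ) (hs : ∀ m : ℕ, s ≠ -(m : ℂ)) :
    HasDerivAt Complex.Gamma (Complex.digamma s * Complex.Gamma s) s := by
  have h := (Complex.differentiableAt_Gamma s hs).hasDerivAt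
  rwa [Complex.digamma_def, logDeriv_apply, div_mul_cancel₀ _ (Complex.Gamma_ne_zero hs)]

lemma hasDerivAt_poleKernel {z x : ℂ} (h0 : x ≠ 0) (hm : x - z ≠ 0) (hp : x + z ≠ 0) :
    HasDerivAt (poleKernel z) (-poleKernelNegDeriv z x) x := by
  have hne : x * (x - z) * (x + z) ≠ 0 := mul_ne_zero (mul_ne_zero h0 hm) hp
  have hid := hasDerivAt_id x
  have hden : HasDerivAt (fun x => x * (x - z) * (x + z)) _ x :=
    (hid.mul (hid.sub_const z)).mul (hid.add_const z)
  have h := (hasDerivAt_const x (2 * z ^ 2)).div hden hne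
  convert! h using 1
  simp only [id, poleKernelNegDeriv, Pi.mul_apply]
  field_simp
  ring

namespace SeriesBounds

variable {z b : ℂ} {C τ : ℝ}

lemma hasDerivAt_gammaProdTerm (h : SeriesBounds z C τ b) (k : ℕ) :
    HasDerivAt (fun b => gammaProdTerm z b k)
      ((-1) ^ k * (2 * Complex.digamma (2 * b + k) * gammaCoeff (2 * b) k * poleKernel z (b + k)) -
        (-1) ^ k * (gammaCoeff (2 * b) k * poleKernelNegDeriv z (b + k))) b := by
  have hs (m : ℕ) : 2 * b + k ≠ -(m : ℂ) := fun e => h.two_mul_ne (k + m) (by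
    push_cast; linear_combination e)
  have hlin : HasDerivAt (fun b : ℂ => 2 * b + k) 2 b := by
    simpa using ((hasDerivAt_id b).const_mul (2 : ℂ)).add_const (k : ℂ)
  have hQ : HasDerivAt (fun b : ℂ => gammaCoeff (2 * b) k)
      (Complex.digamma (2 * b + k) * Complex.Gamma (2 * b + k) * 2 / k.factorial) b :=
    ((hasDerivAt_Gamma _ hs).comp b hlin).div_const _
  have hr : HasDerivAt (fun b : ℂ => poleKernel z (b + k)) (-poleKernelNegDeriv z (b + k)) b :=
    (hasDerivAt_poleKernel (h.ne_zero k) (h.sub_ne_zero k) (h.add_ne_zero k)).comp_add_const b k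
  refine ((hQ.mul hr).const_mul ((-1 : ℂ) ^ k)).congr_deriv ?_
  rw [gammaCoeff]
  ring

lemma summable_gammaCoeff_mul_poleKernelNegDeriv (hτ : τ < 3) (h : SeriesBounds z C τ b) :
    Summable fun k : ℕ => (-1) ^ k * (gammaCoeff (2 * b) k * poleKernelNegDeriv z (b + k)) := by
  have hC : 0 ≤ C := (norm_nonneg _).trans h.norm_le
  have hs : Summable fun k : ℕ => C ^ 2 * ((k : ℝ) + 1) ^ (τ - 4) := by
    refine Summable.mul_left _ ?_
    have := (summable_nat_add_iff 1).2 ((Real.summable_nat_rpow (p := τ - 4)).2 (by linarith))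
    exact this.congr fun k => by push_cast; rfl
  refine Summable.of_norm_bounded hs fun k => ?_
  have hk : (0 : ℝ) < (k : ℝ) + 1 := by positivity
  rw [norm_mul, norm_pow, norm_neg, norm_one, one_pow, one_mul, norm_mul]
  calc _ ≤ C * ((k : ℝ) + 1) ^ τ * (C / ((k : ℝ) + 1) ^ 4) :=
        mul_le_mul (h.coeff_le k) (h.kernelNegDeriv_le k) (norm_nonneg _) (by positivity)
    _ = _ := by
      rw [Real.rpow_sub hk, show (4 : ℝ) = ((4 : ℕ) : ℝ) by norm_num, Real.rpow_natCast]
      ring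

end SeriesBounds

/-- Cauchy's estimate on the circle of radius ε/2 transfers the uniform bound O(k^(τ-3)) to the
derivative, so no growth estimate for digamma is needed. -/
lemma tendsto_deriv_gammaProdTerm {a z : ℂ} {ε C τ : ℝ} (hε : 0 < ε) (hτ : τ < 3)
    (h : ∀ b ∈ ball a ε, SeriesBounds z C τ b) :
    Tendsto (fun k => deriv (fun b => gammaProdTerm z b k) a) atTop (𝓝 0) := by
  have hbound (k : ℕ) : ‖deriv (fun b => gammaProdTerm z b k) a‖ ≤
      C ^ 2 * ((k : ℝ) + 1) ^ (τ - 3) / (ε / 2) := by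
    have hsub : closedBall a (ε / 2) ⊆ ball a ε := closedBall_subset_ball (by linarith)
    refine Complex.norm_deriv_le_of_forall_mem_sphere_norm_le (by linarith) ?_ fun b hb =>
      (h b (hsub (sphere_subset_closedBall hb))).norm_gammaProdTerm_le k
    refine DifferentiableOn.diffContOnCl_ball (U := ball a ε) (fun b hb => ?_) hsub
    exact ((h b hb).hasDerivAt_gammaProdTerm k).differentiableAt.differentiableWithinAt
  refine squeeze_zero_norm hbound ?_
  have h1 : Tendsto (fun k : ℕ => ((k : ℝ) + 1)) atTop atTop :=
    tendsto_natCast_atTop_atTop.atTop_add tendsto_const_nhds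
  have h2 := (tendsto_rpow_neg_atTop (y := 3 - τ) (by linarith)).comp h1
  have h3 := (h2.const_mul (C ^ 2)).div_const (ε / 2)
  rw [mul_zero, zero_div] at h3
  exact h3.congr fun k => by simp

lemma hasSum_deriv_gammaProdTerm_pair {a z : ℂ} {ε C τ : ℝ} (hε : 0 < ε) (hτ : τ < 3)
    (h : ∀ b ∈ ball a ε, SeriesBounds z C τ b) :
    HasSum (fun j => deriv (fun b => gammaProdTerm z b (2 * j)) a +
        deriv (fun b => gammaProdTerm z b (2 * j + 1)) a)
      (Complex.Gamma (a + z) * Complex.Gamma (a - z) *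
        (Complex.digamma (a + z) + Complex.digamma (a - z)) -
        2 * Complex.digamma a * Complex.Gamma a ^ 2) := by
  have hmem : a ∈ ball a ε := mem_ball_self hε
  have ha := h a hmem
  have hdiff (k : ℕ) (b : ℂ) (hb : b ∈ ball a ε) :
      DifferentiableAt ℂ (fun b => gammaProdTerm z b k) b :=
    ((h b hb).hasDerivAt_gammaProdTerm k).differentiableAt
  -- Weierstrass: the paired series has a summable majorant on the whole ball, so its holomorphic
  -- sum is differentiated termwise.
  have hs := Complex.hasSum_deriv_of_summable_norm
    (F := fun j b => gammaProdTerm z b (2 * j) + gammaProdTerm z b (2 * j + 1))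
    (summable_two_mul_add_one_rpow hτ (2 * (1 + C) * C ^ 2))
    (fun j b hb => ((hdiff _ b hb).add (hdiff _ b hb)).differentiableWithinAt) isOpen_ball
    (fun j b hb => (h b hb).norm_gammaProdTerm_pair_le j) hmem
  have e : (fun b : ℂ => ∑' j, (gammaProdTerm z b (2 * j) + gammaProdTerm z b (2 * j + 1))) =ᶠ[𝓝 a]
      fun b => Complex.Gamma (b + z) * Complex.Gamma (b - z) - Complex.Gamma b ^ 2 := by
    filter_upwards [isOpen_ball.mem_nhds hmem] with b hb
    exact ((h b hb).hasSum_gammaProdTerm_pair hτ).tsum_eq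
  have hG0 : HasDerivAt Complex.Gamma _ a := hasDerivAt_Gamma a fun m e => ha.ne_zero m (by
    rw [e]; ring)
  have hG1 : HasDerivAt (fun b => Complex.Gamma (b + z)) _ a :=
    (hasDerivAt_Gamma (a + z) fun m e => ha.add_ne_zero m (by
      linear_combination e)).comp_add_const a z
  have hG2 : HasDerivAt (fun b => Complex.Gamma (b - z)) _ a :=
    (hasDerivAt_Gamma (a - z) fun m e => ha.sub_ne_zero m (by
      linear_combination e)).comp_sub_const a z
  have hG : HasDerivAt (fun b => Complex.Gamma (b + z) * Complex.Gamma (b - z) -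
      Complex.Gamma b ^ 2) _ a := (hG1.mul hG2).sub (hG0.pow 2)
  rw [e.deriv_eq, hG.deriv] at hs
  convert! hs using 1
  · funext j
    exact (deriv_add (hdiff _ a hmem) (hdiff _ a hmem)).symm
  · push_cast
    ring

/-! ### Inner series in closed form, and the conclusion -/

lemma hasSum_termS1 (a z : ℂ) (k : ℕ) (hz : ‖z‖ < ‖a + k‖) :
    HasSum (fun n => termS1 a z k (n + 1))
      ((-1) ^ k * (2 * Complex.digamma (2 * a + k) * gammaCoeff (2 * a) k *
        poleKernel z (a + k))) := by
  have hx : a + k ≠ 0 := norm_pos_iff.1 ((norm_nonneg z).trans_lt hz)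
  have hm : a + k - z ≠ 0 := sub_ne_zero.2 fun e => by rw [e] at hz; exact hz.false
  have hp : a + k + z ≠ 0 := fun e => by
    rw [eq_neg_of_add_eq_zero_left e, norm_neg] at hz; exact hz.false
  have hq : ‖z ^ 2 / (a + k) ^ 2‖ < 1 := by
    rw [← div_pow, norm_pow, norm_div]
    exact pow_lt_one₀ (by positivity) ((div_lt_one (norm_pos_iff.2 hx)).2 hz) two_ne_zero
  have hf : (k.factorial : ℂ) ≠ 0 := by exact_mod_cast k.factorial_ne_zero
  have hd : (a + k) ^ 2 - z ^ 2 ≠ 0 := by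
    rw [show (a + k) ^ 2 - z ^ 2 = (a + k - z) * (a + k + z) by ring]
    exact mul_ne_zero hm hp
  have hone : (1 - z ^ 2 / (a + k) ^ 2)⁻¹ = (a + k) ^ 2 / ((a + k) ^ 2 - z ^ 2) := by
    rw [one_sub_div (pow_ne_zero 2 hx), inv_div]
  convert! (hasSum_geometric_of_norm_lt_one hq).mul_left
    (4 * (-1) ^ k * Complex.digamma (2 * a + k) * gammaCoeff (2 * a) k * z ^ 2 / (a + k) ^ 3) using 1
  · funext n
    rw [termS1, gammaCoeff, div_pow, ← pow_mul, ← pow_mul,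
      show 2 * (n + 1) + 1 = 2 * n + 3 by ring, show 2 * (n + 1) = 2 * n + 2 by ring]
    field_simp
    ring
  · rw [hone, poleKernel, mul_assoc (a + k : ℂ),
      show (a + k - z) * (a + k + z) = (a + k) ^ 2 - z ^ 2 by ring]
    field_simp
    ring

lemma hasSum_termS2 (a z : ℂ) (k : ℕ) (hz : ‖z‖ < ‖a + k‖) :
    HasSum (fun n => termS2 a z k (n + 1))
      ((-1) ^ k * (gammaCoeff (2 * a) k * poleKernelNegDeriv z (a + k))) := by
  have hx : a + k ≠ 0 := norm_pos_iff.1 ((norm_nonneg z).trans_lt hz)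
  have hm : a + k - z ≠ 0 := sub_ne_zero.2 fun e => by rw [e] at hz; exact hz.false
  have hp : a + k + z ≠ 0 := fun e => by
    rw [eq_neg_of_add_eq_zero_left e, norm_neg] at hz; exact hz.false
  have hq : ‖z ^ 2 / (a + k) ^ 2‖ < 1 := by
    rw [← div_pow, norm_pow, norm_div]
    exact pow_lt_one₀ (by positivity) ((div_lt_one (norm_pos_iff.2 hx)).2 hz) two_ne_zero
  have hf : (k.factorial : ℂ) ≠ 0 := by exact_mod_cast k.factorial_ne_zero
  have hd : (a + k) ^ 2 - z ^ 2 ≠ 0 := by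
    rw [show (a + k) ^ 2 - z ^ 2 = (a + k - z) * (a + k + z) by ring]
    exact mul_ne_zero hm hp
  have hone : 1 - z ^ 2 / (a + k) ^ 2 = ((a + k) ^ 2 - z ^ 2) / (a + k) ^ 2 :=
    one_sub_div (pow_ne_zero 2 hx)
  -- With n shifted to n + 1 the factor 2n + 1 becomes 2n + 3, hence 2∑ n qⁿ + 3∑ qⁿ with q =
  -- z²/(a+k)².
  convert! (((hasSum_coe_mul_geometric_of_norm_lt_one hq).mul_left 2).add
    ((hasSum_geometric_of_norm_lt_one hq).mul_left 3)).mul_left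
    (2 * (-1) ^ k * gammaCoeff (2 * a) k * z ^ 2 / (a + k) ^ 4) using 1
  · funext n
    rw [termS2, gammaCoeff, div_pow, ← pow_mul, ← pow_mul,
      show 2 * (n + 1) + 2 = 2 * n + 4 by ring, show 2 * (n + 1) = 2 * n + 2 by ring]
    push_cast
    field_simp
    ring
  · have e : poleKernelNegDeriv z (a + k) =
        2 * z ^ 2 * (3 * (a + k) ^ 2 - z ^ 2) / ((a + k) ^ 2 * ((a + k) ^ 2 - z ^ 2) ^ 2) := by
      rw [poleKernelNegDeriv,
        show (a + k) ^ 2 - z ^ 2 = (a + k - z) * (a + k + z) by ring]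
      field_simp
      ring
    rw [hone, e]
    field_simp
    ring

theorem theorem7 (a z : ℂ) (ha : a.re < 2) (h2a : ∀ m : ℕ, 2 * a ≠ -(m : ℂ))
    (hz : ∀ k : ℕ, ‖z‖ < ‖a + k‖) :
    ∃ S₁ S₂ : ℂ, HasIteratedSum (termS1 a z) S₁ ∧ HasIteratedSum (termS2 a z) S₂ ∧
      Complex.Gamma (a + z) * Complex.Gamma (a - z) *
          (Complex.digamma (a + z) + Complex.digamma (a - z)) =
        2 * Complex.digamma a * Complex.Gamma a ^ 2 + S₁ - S₂ := by
  have hm (k : ℕ) : a - z + k ≠ 0 := fun e => by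
    have h := hz k
    rw [show a + k = z by linear_combination e] at h
    exact h.false
  have hp (k : ℕ) : a + z + k ≠ 0 := fun e => by
    have h := hz k
    rw [show a + k = -z by linear_combination e, norm_neg] at h
    exact h.false
  obtain ⟨ε, C, τ, hε, -, hτ, h⟩ := exists_ball_seriesBounds a z ha h2a hm hp
  have hA := h a (mem_ball_self hε)
  have hL := tendsto_sum_range_of_tendsto_sum_pairs (tendsto_deriv_gammaProdTerm hε hτ h)
    (hasSum_deriv_gammaProdTerm_pair hε hτ h).tendsto_sum_nat
  have h2 := (hA.summable_gammaCoeff_mul_poleKernelNegDeriv hτ).hasSum.tendsto_sum_nat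
  -- The derivative series converges to S₁ - S₂ and the outer series of S₂ converges absolutely, so
  -- convergence of S₁ follows by addition.
  refine ⟨_, _, ⟨_, fun k => hasSum_termS1 a z k (hz k), (hL.add h2).congr fun N => ?_⟩,
    ⟨_, fun k => hasSum_termS2 a z k (hz k), h2⟩, by ring⟩
  rw [← sum_add_distrib]
  refine sum_congr rfl fun k _ => ?_
  rw [(hA.hasDerivAt_gammaProdTerm k).deriv, sub_add_cancel]
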